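/- Let $\nu$ be a probability measure on $\mathbb{R}$. For every $N$ consider the random game with player set $[N]=\{1,\dots,N\}$ in which every player has the action set $\{0,1\}$, and in which the payoff of player $i$ at the action profile $s\in\{0,1\}^N$ is a real random variable $Z_i^s$, the random variables $(Z_i^s)_{i\in[N],\,s\in\{0,1\}^N}$ being independent with common law $\nu$, where $\nu$ does not depend on $N$. An action profile $s$ is a strict pure Nash equilibrium if, for every player $i$, replacing the action $s_i$ by the other action (all other actions unchanged) strictly decreases the payoff of player $i$. Let $W_N$ be the number of strict pure Nash equilibria of this game, and let $\alpha=\mathsf{P}(Z_1=Z_2)$, where $Z_1,Z_2$ are independent random variables with law $\nu$. 1. If $\alpha=0$, then $W_N$ converges in distribution, as $N\to\infty$, to a Poisson random variable with parameter $1$. 2. If $\alpha>0$, then $W_N=0$ with very high probability, that is, $\sum_{N=1}^{\infty}\bigl(1-\mathsf{P}(W_N=0)\bigr)<\infty$. 3. For every $N$ and every value of $\alpha$, $\mathsf{E}[W_N]=(1-\alpha)^N$. -/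

import Mathlib

open Filter MeasureTheory ProbabilityTheory

/-- `s` is a strict pure Nash equilibrium of the game in which the players are the elements of `ι`,
player `i` has the set of actions `S i` and the payoff function `g i`: every unilateral deviation
of a player `i` to an action `a` different from `s i` gives `i` a strictly smaller payoff. -/
def IsStrictPureNash {ι : Type*} [DecidableEq ι] {S : ι → Type*}
    (g : ι → (∀ i, S i) → ℝ) (s : ∀ i, S i) : Prop :=
  ∀ (i : ι) (a : S i), a ≠ s i → g i (Function.update s i a) < g i s

/-- The number of strict pure Nash equilibria of a game with `N` players and the two actions
`0, 1` for each player. -/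
noncomputable def numStrictPureNash {N : ℕ} (g : Fin N → (Fin N → Fin 2) → ℝ) : ℕ :=
  {s : Fin N → Fin 2 | IsStrictPureNash (S := fun _ => Fin 2) g s}.ncard

/-- The probability that two independent random variables of law `ν` are equal. -/
noncomputable def tieProbability (ν : Measure ℝ) : ℝ :=
  (ν.prod ν).real {p : ℝ × ℝ | p.1 = p.2}

/-- The events `A 1, A 2, …` (where `A k` is an event of the probability space `(Ω k, P k)`) happen
with very high probability: `∑_{k ≥ 1} (1 - P(A k)) < ∞`. -/
def WithVeryHighProbability {Ω : ℕ → Type*} [∀ k, MeasurableSpace (Ω k)]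
    (P : ∀ k, Measure (Ω k)) (A : ∀ k, Set (Ω k)) : Prop :=
  Summable fun k : ℕ => 1 - (P (k + 1)).real (A (k + 1))

/-!
The equilibrium condition at a profile `s` compares, for each player `i`, the payoffs of `i` at `s`
and at its neighbour `flipAction i s` in the hypercube. If a set of profiles contains no two
neighbours, the pairs of payoffs compared are pairwise disjoint, so the comparisons are independent,
each with probability `p = (1 - α) / 2`. Two neighbours are never both equilibria. Hence the `k`-th
factorial moment of the number `W` of equilibria is `p ^ (N * k)` times the number of ordered
`k`-tuples of distinct pairwise non-adjacent profiles
(`integral_descFactorial_numStrictPureNash`). For `k = 1` this is `(2 * p) ^ N = (1 - α) ^ N`, and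
if `α > 0` Markov's inequality bounds `P(W ≠ 0)` by this summable geometric sequence.

If `α = 0`, then `p = 1 / 2`. Since a profile has only `N` neighbours, almost all `k`-tuples are
distinct and non-adjacent (`pow_mul_le_numNonadjacent_mul_add`), so the binomial moments
`E[W.choose k]` are at most `1 / k!` and converge to `1 / k!`, the binomial moments of the Poisson
law of parameter `1`. Convergence in distribution follows from Newton's formula
`f n = ∑ k, n.choose k * (Δ^k f) 0` for bounded `f`: as `|(Δ^k f) 0| ≤ 2 ^ k * ‖f‖`, the series for
`E[f W]` is dominated by `∑ k, 2 ^ k * ‖f‖ / k!`, and the limit can be taken term by term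
(`tendsto_poissonMeasure_of_tendsto_integral_choose`).
-/

/-! ### Binomial moments and convergence to a Poisson law -/

lemma abs_fwdDiff_iter_le {f : ℕ → ℝ} {C : ℝ} (hf : ∀ n, |f n| ≤ C) (k n : ℕ) :
    |(fwdDiff 1)^[k] f n| ≤ 2 ^ k * C := by
  induction k generalizing n with
  | zero => simpa using hf n
  | succ k ih =>
    rw [Function.iterate_succ_apply', fwdDiff]
    calc |(fwdDiff 1)^[k] f (n + 1) - (fwdDiff 1)^[k] f n|
        ≤ |(fwdDiff 1)^[k] f (n + 1)| + |(fwdDiff 1)^[k] f n| := abs_sub _ _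
      _ ≤ 2 ^ k * C + 2 ^ k * C := add_le_add (ih _) (ih _)
      _ = 2 ^ (k + 1) * C := by ring

lemma summable_two_pow_mul_mul_pow_div_factorial (C r : ℝ) :
    Summable fun k : ℕ => 2 ^ k * C * (r ^ k / k.factorial) := by
  refine ((Real.summable_pow_div_factorial (2 * r)).mul_left C).congr fun k => ?_
  rw [mul_pow]; ring

/-- The Gregory-Newton expansion `f n = ∑ k, n.choose k * (Δ^k f) 0`, integrated term by term. -/
lemma integral_eq_tsum_fwdDiff_mul_integral_choose {μ : Measure ℕ} {f : ℕ → ℝ} {C r : ℝ}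
    (hf : ∀ n, |f n| ≤ C)
    (hint : ∀ k, Integrable (fun n : ℕ => (n.choose k : ℝ)) μ)
    (hle : ∀ k, ∫ n, (n.choose k : ℝ) ∂μ ≤ r ^ k / k.factorial) :
    ∫ n, f n ∂μ = ∑' k, (fwdDiff 1)^[k] f 0 * ∫ n, (n.choose k : ℝ) ∂μ := by
  have hnewton (n : ℕ) : f n = ∑' k, (fwdDiff 1)^[k] f 0 * (n.choose k : ℝ) := by
    rw [tsum_eq_sum (s := Finset.range (n + 1))]
    · simpa [mul_comm] using shift_eq_sum_fwdDiff_iter 1 f n 0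
    · intro k hk
      rw [Nat.choose_eq_zero_of_lt (by simpa [Nat.lt_succ_iff] using hk)]
      simp
  have hsum : Summable fun k => ∫ n, ‖(fwdDiff 1)^[k] f 0 * (n.choose k : ℝ)‖ ∂μ := by
    refine Summable.of_nonneg_of_le (fun k => integral_nonneg fun n => norm_nonneg _) (fun k => ?_)
      (summable_two_pow_mul_mul_pow_div_factorial C r)
    simp_rw [norm_mul, Real.norm_natCast]
    rw [integral_const_mul]
    exact mul_le_mul (abs_fwdDiff_iter_le hf k 0) (hle k) (integral_nonneg fun n => by positivity)
      ((abs_nonneg _).trans (abs_fwdDiff_iter_le hf k 0))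
  rw [integral_congr_ae (Eventually.of_forall hnewton),
    ← (hasSum_integral_of_summable_integral_norm (fun k => (hint k).const_mul _) hsum).tsum_eq]
  simp_rw [integral_const_mul]

/-- The `k`-th binomial moment of the Poisson law of parameter `r` is `r ^ k / k!`. -/
lemma hasSum_poisson_choose (r : ℝ) (k : ℕ) :
    HasSum (fun n : ℕ => Real.exp (-r) * r ^ n / n.factorial * n.choose k)
      (r ^ k / k.factorial) := by
  have hshift : HasSum (fun j : ℕ => Real.exp (-r) * r ^ (j + k) / (j + k).factorial *
      (j + k).choose k) (r ^ k / k.factorial) := by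
    have h := (NormedSpace.expSeries_div_hasSum_exp r).mul_left
      (Real.exp (-r) * (r ^ k / k.factorial))
    rw [← Real.exp_eq_exp_ℝ, mul_right_comm, ← Real.exp_add, neg_add_cancel, Real.exp_zero,
      one_mul] at h
    refine h.congr_fun fun j => ?_
    have hc : ((j + k).choose k : ℝ) * j.factorial * k.factorial = (j + k).factorial := by
      exact_mod_cast by
        rw [mul_right_comm]
        simpa using Nat.choose_mul_factorial_mul_factorial (Nat.le_add_left k j)
    rw [← hc, pow_add]
    have : ((j + k).choose k : ℝ) ≠ 0 :=
      Nat.cast_ne_zero.2 (Nat.choose_pos (Nat.le_add_left k j)).ne'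
    field_simp
  -- The terms with `n < k` vanish, so it suffices to sum over `n = j + k`.
  refine (hasSum_nat_add_iff' k).1 ?_
  convert! hshift using 1
  rw [Finset.sum_eq_zero, sub_zero]
  intro n hn
  rw [Nat.choose_eq_zero_of_lt (Finset.mem_range.1 hn)]
  simp

open scoped NNReal

lemma integrable_choose_poissonMeasure (r : ℝ≥0) (k : ℕ) :
    Integrable (fun n : ℕ => (n.choose k : ℝ)) (poissonMeasure r) := by
  rw [integrable_poissonMeasure_iff]
  simpa using (hasSum_poisson_choose r k).summable

lemma integral_choose_poissonMeasure (r : ℝ≥0) (k : ℕ) :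
    ∫ n, (n.choose k : ℝ) ∂(poissonMeasure r) = r ^ k / k.factorial := by
  rw [integral_poissonMeasure]
  simpa using (hasSum_poisson_choose r k).tsum_eq

/-- Convergence of binomial moments to those of a Poisson law, with domination by them, implies
weak convergence. The domination makes the Newton expansions of `∫ f` converge uniformly. -/
theorem tendsto_poissonMeasure_of_tendsto_integral_choose {r : ℝ≥0}
    {μ : ℕ → ProbabilityMeasure ℕ}
    (hint : ∀ N k, Integrable (fun n : ℕ => (n.choose k : ℝ)) (μ N : Measure ℕ))
    (hle : ∀ N k, ∫ n, (n.choose k : ℝ) ∂(μ N : Measure ℕ) ≤ r ^ k / k.factorial)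
    (hlim : ∀ k, Tendsto (fun N => ∫ n, (n.choose k : ℝ) ∂(μ N : Measure ℕ)) atTop
      (nhds (r ^ k / k.factorial))) :
    Tendsto μ atTop (nhds ⟨poissonMeasure r, inferInstance⟩) := by
  refine ProbabilityMeasure.tendsto_iff_forall_integral_tendsto.2 ?_
  intro f
  have hf (n : ℕ) : |f n| ≤ ‖f‖ := f.norm_coe_le_norm n
  simp_rw [fun N => integral_eq_tsum_fwdDiff_mul_integral_choose hf (hint N) (hle N)]
  rw [ProbabilityMeasure.coe_mk, integral_eq_tsum_fwdDiff_mul_integral_choose (r := r) hf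
    (integrable_choose_poissonMeasure r) fun k => (integral_choose_poissonMeasure r k).le]
  refine tendsto_tsum_of_dominated_convergence
    (summable_two_pow_mul_mul_pow_div_factorial ‖f‖ r) (fun k => ?_)
    (Eventually.of_forall fun N k => ?_)
  · rw [integral_choose_poissonMeasure]
    exact (hlim k).const_mul _
  · rw [norm_mul, Real.norm_of_nonneg (integral_nonneg fun n => by positivity)]
    exact mul_le_mul (abs_fwdDiff_iter_le hf k 0) (hle N k)
      (integral_nonneg fun n => by positivity)
      ((abs_nonneg _).trans (abs_fwdDiff_iter_le hf k 0))

/-! ### Comparisons of independent identically distributed variables -/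

/-- The map regrouping a family of pairs into a family indexed by `ι ⊕ ι` preserves the product
measures. -/
lemma measurePreserving_pi_prod_sumElim {ι : Type*} [Fintype ι] (ν : Measure ℝ)
    [IsProbabilityMeasure ν] :
    MeasurePreserving (fun (y : ι → ℝ × ℝ) => Sum.elim (fun i => (y i).1) (fun i => (y i).2))
      (Measure.pi fun _ : ι => ν.prod ν) (Measure.pi fun _ : ι ⊕ ι => ν) := by
  have hmeas : Measurable (fun (y : ι → ℝ × ℝ) =>
      Sum.elim (fun i => (y i).1) (fun i => (y i).2)) := by
    refine measurable_pi_iff.2 ?_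
    rintro (i | i) <;> simp only [Sum.elim_inl, Sum.elim_inr] <;> fun_prop
  refine ⟨hmeas, (Measure.pi_eq fun s hs => ?_).symm⟩
  rw [Measure.map_apply hmeas (MeasurableSet.univ_pi hs)]
  have hpre : (fun (y : ι → ℝ × ℝ) => Sum.elim (fun i => (y i).1) (fun i => (y i).2)) ⁻¹'
      (Set.univ.pi s) = Set.univ.pi fun i => s (Sum.inl i) ×ˢ s (Sum.inr i) := by
    ext y
    simp [Set.mem_pi, forall_and]
  rw [hpre, Measure.pi_pi, Fintype.prod_sum_type]
  simp_rw [Measure.prod_prod]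
  exact Finset.prod_mul_distrib

/-- Comparisons of disjoint pairs of independent variables of law `ν` are independent. -/
lemma measureReal_forall_lt_of_iIndepFun {ι κ Ω : Type*} [Fintype ι] [MeasurableSpace Ω]
    {P : Measure Ω} {ν : Measure ℝ} [IsProbabilityMeasure ν] {X : κ → Ω → ℝ}
    (hlaw : ∀ p, HasLaw (X p) ν P) (hindep : iIndepFun X P) {a b : ι → κ}
    (hab : Function.Injective (Sum.elim a b)) :
    P.real {ω | ∀ i, X (b i) ω < X (a i) ω} =
      (ν.prod ν).real {q | q.2 < q.1} ^ Fintype.card ι := by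
  have hX : HasLaw (fun ω (c : ι ⊕ ι) => X (Sum.elim a b c) ω) (Measure.pi fun _ => ν) P := by
    refine ⟨aemeasurable_pi_lambda _ fun c => (hlaw _).aemeasurable, ?_⟩
    rw [(hindep.precomp hab).map_fun_eq_pi_map fun c => (hlaw _).aemeasurable]
    simp_rw [(hlaw _).map_eq]
  have hms : MeasurableSet {x : ι ⊕ ι → ℝ | ∀ i, x (Sum.inr i) < x (Sum.inl i)} := by
    simp_rw [Set.ofPred_forall]
    exact MeasurableSet.iInter fun i =>
      measurableSet_lt (measurable_pi_apply _) (measurable_pi_apply _)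
  have h1 := hX.measure_eq (p := fun x => ∀ i, x (Sum.inr i) < x (Sum.inl i)) hms
  have hpre : (fun (y : ι → ℝ × ℝ) => Sum.elim (fun i => (y i).1) (fun i => (y i).2)) ⁻¹'
      {x : ι ⊕ ι → ℝ | ∀ i, x (Sum.inr i) < x (Sum.inl i)} =
      Set.univ.pi fun _ => {q : ℝ × ℝ | q.2 < q.1} := by
    ext y
    simp [Set.mem_pi]
  rw [← (measurePreserving_pi_prod_sumElim ν).measure_preimage hms.nullMeasurableSet, hpre,
    Measure.pi_pi, Finset.prod_const] at h1
  simp only [Sum.elim_inl, Sum.elim_inr] at h1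
  rw [measureReal_def, h1, ENNReal.toReal_pow, measureReal_def, Finset.card_univ]

/-- By symmetry, `P(Z₁ > Z₂) = (1 - P(Z₁ = Z₂)) / 2`. -/
lemma measureReal_prod_lt_eq (ν : Measure ℝ) [IsProbabilityMeasure ν] :
    (ν.prod ν).real {q | q.2 < q.1} = (1 - tieProbability ν) / 2 := by
  have hgt : MeasurableSet {q : ℝ × ℝ | q.2 < q.1} := measurableSet_lt (by fun_prop) (by fun_prop)
  have hlt : MeasurableSet {q : ℝ × ℝ | q.1 < q.2} := measurableSet_lt (by fun_prop) (by fun_prop)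
  have hswap : (ν.prod ν).real {q | q.1 < q.2} = (ν.prod ν).real {q | q.2 < q.1} :=
    congrArg ENNReal.toReal ((Measure.measurePreserving_swap (μ := ν) (ν := ν)).measure_preimage
      hgt.nullMeasurableSet)
  have hcompl : {q : ℝ × ℝ | q.1 = q.2} = ({q | q.2 < q.1} ∪ {q | q.1 < q.2})ᶜ := by
    ext q
    simp [le_antisymm_iff]
  have hdisj : Disjoint {q : ℝ × ℝ | q.2 < q.1} {q | q.1 < q.2} :=
    Set.disjoint_left.2 fun q h h' => lt_asymm (Set.mem_ofPred.1 h) (Set.mem_ofPred.1 h')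
  rw [tieProbability, hcompl, probReal_compl_eq_one_sub (hgt.union hlt),
    measureReal_union hdisj hlt, hswap]
  ring

/-! ### Tuples of pairwise non-adjacent action profiles -/

/-- The profile obtained from `s` when player `i` switches to the other action. Profiles of the form
`s` and `flipAction i s` are the edges of the hypercube. -/
def flipAction {N : ℕ} (i : Fin N) (s : Fin N → Fin 2) : Fin N → Fin 2 :=
  Function.update s i (s i + 1)

lemma fin_two_ne_iff_eq_add_one (a b : Fin 2) : a ≠ b ↔ a = b + 1 := by
  revert a b; decide

lemma flipAction_apply_self {N : ℕ} (i : Fin N) (s : Fin N → Fin 2) :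
    flipAction i s i = s i + 1 := by
  simp [flipAction]

lemma flipAction_flipAction {N : ℕ} (i : Fin N) (s : Fin N → Fin 2) :
    flipAction i (flipAction i s) = s := by
  have h (a : Fin 2) : a + 1 + 1 = a := by revert a; decide
  simp [flipAction, h]

lemma flipAction_ne_self {N : ℕ} (i : Fin N) (s : Fin N → Fin 2) : flipAction i s ≠ s := by
  intro h
  have := congrFun h i
  rw [flipAction_apply_self] at this
  exact (fin_two_ne_iff_eq_add_one _ _).2 rfl this

lemma flipAction_injective {N : ℕ} (i : Fin N) : Function.Injective (flipAction i) :=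
  (show Function.Involutive (flipAction i) from flipAction_flipAction i).injective

lemma isStrictPureNash_iff_flipAction {N : ℕ} {g : Fin N → (Fin N → Fin 2) → ℝ}
    {s : Fin N → Fin 2} :
    IsStrictPureNash (S := fun _ => Fin 2) g s ↔ ∀ i, g i (flipAction i s) < g i s := by
  simp [IsStrictPureNash, flipAction, fin_two_ne_iff_eq_add_one]

/-- No two of the profiles `f j` differ in the action of exactly one player. -/
def PairwiseNonadjacent {N k : ℕ} (f : Fin k → Fin N → Fin 2) : Prop :=
  ∀ (i : Fin N) (j l : Fin k), flipAction i (f j) ≠ f l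

/-- The number of ordered `k`-tuples of distinct, pairwise non-adjacent action profiles. -/
noncomputable def numNonadjacent (N k : ℕ) : ℕ :=
  Nat.card {f : Fin k ↪ (Fin N → Fin 2) // PairwiseNonadjacent f}

lemma numNonadjacent_one (N : ℕ) : numNonadjacent N 1 = 2 ^ N := by
  have h (f : Fin 1 ↪ (Fin N → Fin 2)) : PairwiseNonadjacent f := fun i j l => by
    rw [Subsingleton.elim l j]
    exact flipAction_ne_self i _
  rw [numNonadjacent, Nat.card_congr (Equiv.subtypeUnivEquiv h), Nat.card_eq_fintype_card]
  simp

lemma numNonadjacent_le_pow (N k : ℕ) : numNonadjacent N k ≤ (2 ^ N) ^ k := by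
  have h : Function.Injective
      (fun f : {f : Fin k ↪ (Fin N → Fin 2) // PairwiseNonadjacent f} => (f.1 : Fin k → _)) :=
    fun f g h => Subtype.ext (DFunLike.coe_injective h)
  simpa [numNonadjacent] using Nat.card_le_card_of_injective _ h

lemma numNonadjacent_div_le_one (N k : ℕ) : (numNonadjacent N k : ℝ) / (2 ^ N) ^ k ≤ 1 := by
  refine div_le_one_of_le₀ ?_ (by positivity)
  have h := numNonadjacent_le_pow N k
  exact_mod_cast h

lemma card_filter_apply_eq_mul_le {α V : Type*} [Fintype α] [DecidableEq α] [Fintype V]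
    [DecidableEq V] {a b : α} (hab : a ≠ b) (φ : V → V) :
    (Finset.univ.filter fun f : α → V => f b = φ (f a)).card * Fintype.card V ≤
      Fintype.card V ^ Fintype.card α := by
  rw [← Finset.card_univ (α := V), ← Finset.card_product, Finset.card_univ, ← Fintype.card_fun,
    ← Finset.card_univ]
  -- The value at `b` is redundant, so it can be overwritten by the additional element of `V`.
  refine Finset.card_le_card_of_injOn (fun x => Function.update x.1 b x.2) (by simp) ?_
  rintro ⟨f, v⟩ hf ⟨g, w⟩ hg h
  simp only [Finset.coe_product, Set.mem_prod, Finset.coe_filter, Finset.mem_univ, true_and,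
    Set.mem_ofPred_eq] at hf hg
  have hoff (c : α) (hc : c ≠ b) : f c = g c := by
    simpa [Function.update_of_ne hc] using congrFun h c
  have hvw : v = w := by simpa using congrFun h b
  refine Prod.ext (funext fun c => ?_) hvw
  by_cases hc : c = b
  · rw [hc]
    exact hf.1.trans ((congrArg φ (hoff a hab)).trans hg.1.symm)
  · exact hoff c hc

/-- All but a fraction `k² (N + 1) / 2 ^ N` of the `k`-tuples of profiles are good: a bad tuple has
two entries `f a`, `f b` such that `f b` is one of the `N + 1` profiles equal or adjacent
to `f a`. -/
lemma pow_mul_le_numNonadjacent_mul_add (N k : ℕ) :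
    (2 ^ N) ^ k * 2 ^ N ≤ numNonadjacent N k * 2 ^ N + k ^ 2 * (N + 1) * (2 ^ N) ^ k := by
  classical
  -- `φ none` is the identity and `φ (some i)` flips the action of player `i`, so `bad ((a, b), o)`
  -- consists of the tuples `f` in which `f b` is the profile `φ o (f a)`.
  let φ : Option (Fin N) → (Fin N → Fin 2) → (Fin N → Fin 2) := fun o => o.elim id flipAction
  let good : Finset (Fin k → Fin N → Fin 2) :=
    (Finset.univ.filter fun f : Fin k ↪ (Fin N → Fin 2) => PairwiseNonadjacent f).image (⇑)
  let idx : Finset ((Fin k × Fin k) × Option (Fin N)) :=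
    Finset.univ.filter fun x => x.1.1 ≠ x.1.2
  let bad : (Fin k × Fin k) × Option (Fin N) → Finset (Fin k → Fin N → Fin 2) := fun x =>
    Finset.univ.filter fun f => f x.1.2 = φ x.2 (f x.1.1)
  have hgood : good.card ≤ numNonadjacent N k := by
    rw [numNonadjacent, Nat.card_eq_fintype_card, Fintype.card_subtype]
    exact Finset.card_image_le
  have hidx : idx.card ≤ k ^ 2 * (N + 1) := by
    refine (Finset.card_le_univ _).trans_eq ?_
    simp [sq]
  have hcover : (Finset.univ : Finset (Fin k → Fin N → Fin 2)) ⊆ good ∪ idx.biUnion bad := by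
    intro f _
    by_contra hf
    simp only [Finset.mem_union, not_or, Finset.mem_biUnion, not_exists, not_and] at hf
    obtain ⟨hfg, hfb⟩ := hf
    have hne (o : Option (Fin N)) (a b : Fin k) (h : a ≠ b) : f b ≠ φ o (f a) := by
      simpa [idx, bad, h] using hfb ((a, b), o)
    refine hfg (Finset.mem_image.2 ⟨⟨f, fun a b h => ?_⟩, ?_, rfl⟩)
    · by_contra hab
      exact hne none a b hab h.symm
    · refine Finset.mem_filter.2 ⟨Finset.mem_univ _, fun i j l h => ?_⟩
      by_cases hjl : j = l
      · subst hjl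
        exact flipAction_ne_self i _ h
      · exact hne (some i) j l hjl h.symm
  have hcard : (2 ^ N) ^ k ≤ good.card + ∑ x ∈ idx, (bad x).card := by
    calc (2 ^ N) ^ k = (Finset.univ : Finset (Fin k → Fin N → Fin 2)).card := by simp
      _ ≤ (good ∪ idx.biUnion bad).card := Finset.card_le_card hcover
      _ ≤ good.card + (idx.biUnion bad).card := Finset.card_union_le _ _
      _ ≤ good.card + ∑ x ∈ idx, (bad x).card := by
        gcongr
        exact Finset.card_biUnion_le
  have hbad (x) (hx : x ∈ idx) : (bad x).card * 2 ^ N ≤ (2 ^ N) ^ k := by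
    simpa using card_filter_apply_eq_mul_le (V := Fin N → Fin 2) (Finset.mem_filter.1 hx).2 (φ x.2)
  calc (2 ^ N) ^ k * 2 ^ N ≤ (good.card + ∑ x ∈ idx, (bad x).card) * 2 ^ N := by gcongr
    _ = good.card * 2 ^ N + ∑ x ∈ idx, (bad x).card * 2 ^ N := by rw [add_mul, Finset.sum_mul]
    _ ≤ good.card * 2 ^ N + idx.card * (2 ^ N) ^ k := by
      gcongr
      simpa using Finset.sum_le_card_nsmul idx _ _ hbad
    _ ≤ _ := by gcongr

lemma tendsto_numNonadjacent_div (k : ℕ) :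
    Tendsto (fun N => (numNonadjacent N k : ℝ) / (2 ^ N) ^ k) atTop (nhds 1) := by
  have hzero : Tendsto (fun N : ℕ => (k : ℝ) ^ 2 * ((N + 1) / 2 ^ N)) atTop (nhds 0) := by
    have h1 := tendsto_pow_const_div_const_pow_of_one_lt 1 (r := (2 : ℝ)) (by norm_num)
    have h0 := tendsto_pow_const_div_const_pow_of_one_lt 0 (r := (2 : ℝ)) (by norm_num)
    simpa [add_div] using (h1.add h0).const_mul ((k : ℝ) ^ 2)
  refine tendsto_of_tendsto_of_tendsto_of_le_of_le (by simpa using hzero.const_sub 1)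
    tendsto_const_nhds (fun N => ?_) fun N => ?_
  · have h : ((2 : ℝ) ^ N) ^ k * 2 ^ N ≤
        numNonadjacent N k * 2 ^ N + k ^ 2 * (N + 1) * (2 ^ N) ^ k := by
      exact_mod_cast pow_mul_le_numNonadjacent_mul_add N k
    have hN : (0 : ℝ) < 2 ^ N := by positivity
    have hNk : (0 : ℝ) < (2 ^ N) ^ k := by positivity
    rw [le_div_iff₀ hNk, ← mul_le_mul_iff_left₀ hN]
    refine le_trans (le_of_eq ?_) (sub_le_iff_le_add.2 h)
    field_simp
  · exact numNonadjacent_div_le_one N k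

/-! ### Factorial moments of the number of equilibria -/

lemma descFactorial_ncard_eq_card_embedding {V : Type*} [Finite V] (p : V → Prop) (k : ℕ) :
    {s | p s}.ncard.descFactorial k = Nat.card {f : Fin k ↪ V // ∀ j, p (f j)} := by
  classical
  have := Fintype.ofFinite V
  let e : {f : Fin k ↪ V // ∀ j, p (f j)} ≃ (Fin k ↪ {s // p s}) :=
    { toFun := fun f => ⟨fun j => ⟨f.1 j, f.2 j⟩, fun a b h => f.1.injective (congrArg (·.1) h)⟩
      invFun := fun f => ⟨f.trans (Function.Embedding.subtype _), fun j => (f j).2⟩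
      left_inv := fun f => rfl
      right_inv := fun f => rfl }
  rw [Nat.card_congr e, Nat.card_eq_fintype_card, Fintype.card_embedding_eq, Fintype.card_fin,
    ← Nat.card_coe_set_eq, Nat.card_eq_fintype_card]
  rfl

section RandomGame

variable {N : ℕ} {Ω : Type*} {Z : Fin N → (Fin N → Fin 2) → Ω → ℝ}

lemma descFactorial_numStrictPureNash_eq_sum (k : ℕ) (ω : Ω) :
    ((numStrictPureNash fun i s => Z i s ω).descFactorial k : ℝ) =
      ∑ f : Fin k ↪ (Fin N → Fin 2), {ω | ∀ j, IsStrictPureNash (S := fun _ => Fin 2)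
        (fun i s => Z i s ω) (f j)}.indicator (fun _ => (1 : ℝ)) ω := by
  classical
  rw [numStrictPureNash, descFactorial_ncard_eq_card_embedding, Nat.card_eq_fintype_card,
    Fintype.card_subtype, Finset.card_filter]
  simp only [Nat.cast_sum, Nat.cast_ite, Nat.cast_one, Nat.cast_zero, Set.indicator_apply,
    Set.mem_ofPred_eq]

variable [MeasurableSpace Ω] {P : Measure Ω} {ν : Measure ℝ}

lemma nullMeasurableSet_isStrictPureNash (hZ : ∀ i s, AEMeasurable (Z i s) P)
    (s : Fin N → Fin 2) :
    NullMeasurableSet {ω | IsStrictPureNash (S := fun _ => Fin 2) (fun i s => Z i s ω) s} P := by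
  simp_rw [isStrictPureNash_iff_flipAction, Set.ofPred_forall]
  exact NullMeasurableSet.iInter fun i => nullMeasurableSet_lt (hZ _ _) (hZ _ _)

lemma aemeasurable_numStrictPureNash (hZ : ∀ i s, AEMeasurable (Z i s) P) :
    AEMeasurable (fun ω => numStrictPureNash fun i s => Z i s ω) P := by
  classical
  have h (ω : Ω) : numStrictPureNash (fun i s => Z i s ω) =
      ∑ s : Fin N → Fin 2, {ω | IsStrictPureNash (S := fun _ => Fin 2)
        (fun i s => Z i s ω) s}.indicator (fun _ => 1) ω := by
    rw [numStrictPureNash, ← Nat.card_coe_set_eq, Nat.card_eq_fintype_card]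
    simp [Fintype.card_subtype, Set.indicator_apply]
  simp_rw [h]
  exact Finset.aemeasurable_fun_sum _ fun s _ =>
    aemeasurable_const.indicator₀ (nullMeasurableSet_isStrictPureNash hZ s)

/-- Distinct pairwise non-adjacent profiles are equilibria independently of each other, since their
equilibrium conditions involve disjoint pairs of payoffs. Adjacent profiles are never both
equilibria. -/
lemma measureReal_forall_isStrictPureNash [IsProbabilityMeasure ν]
    (hlaw : ∀ i s, HasLaw (Z i s) ν P)
    (hindep : iIndepFun (fun p : Fin N × (Fin N → Fin 2) => Z p.1 p.2) P) {k : ℕ}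
    (f : Fin k ↪ (Fin N → Fin 2)) [Decidable (PairwiseNonadjacent f)] :
    P.real {ω | ∀ j, IsStrictPureNash (S := fun _ => Fin 2) (fun i s => Z i s ω) (f j)} =
      if PairwiseNonadjacent f then ((1 - tieProbability ν) / 2) ^ (N * k) else 0 := by
  simp_rw [isStrictPureNash_iff_flipAction]
  split_ifs with hf
  -- The comparisons are indexed by player `i` and index `j`: player `i` compares the payoffs at
  -- `f j` and at `flipAction i (f j)`. Non-adjacency makes all these payoffs distinct.
  · have hab : Function.Injective (Sum.elim (fun x : Fin N × Fin k => (x.1, f x.2))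
        fun x : Fin N × Fin k => (x.1, flipAction x.1 (f x.2))) := by
      refine Function.Injective.sumElim ?_ ?_ ?_
      · rintro ⟨i, j⟩ ⟨i', j'⟩ h
        simpa using h
      · rintro ⟨i, j⟩ ⟨i', j'⟩ h
        obtain ⟨rfl, h⟩ := Prod.ext_iff.1 h
        simpa using flipAction_injective _ h
      · rintro ⟨i, j⟩ ⟨i', j'⟩ h
        exact hf _ _ _ (Prod.ext_iff.1 h).2.symm
    have h := measureReal_forall_lt_of_iIndepFun (fun p => hlaw p.1 p.2) hindep hab
    rw [measureReal_prod_lt_eq, Fintype.card_prod, Fintype.card_fin, Fintype.card_fin] at h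
    rw [← h]
    congr 1
    ext ω
    simp only [Set.mem_ofPred_eq, Prod.forall]
    exact forall_comm
  -- Adjacent profiles `f j` and `f l` impose opposite inequalities on player `i`.
  · simp only [PairwiseNonadjacent, not_forall, not_not] at hf
    obtain ⟨i, j, l, h⟩ := hf
    convert measureReal_empty
    refine Set.eq_empty_of_forall_notMem fun ω hω => ?_
    have h1 := hω j i
    have h2 := hω l i
    rw [← h, flipAction_flipAction] at h2
    exact lt_asymm h1 h2

lemma integrable_descFactorial_numStrictPureNash [IsProbabilityMeasure P]
    (hZ : ∀ i s, AEMeasurable (Z i s) P) (k : ℕ) :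
    Integrable (fun ω => ((numStrictPureNash fun i s => Z i s ω).descFactorial k : ℝ)) P := by
  simp_rw [descFactorial_numStrictPureNash_eq_sum]
  refine integrable_finsetSum _ fun f _ => (integrable_const _).indicator₀ ?_
  rw [Set.ofPred_forall]
  exact NullMeasurableSet.iInter fun j => nullMeasurableSet_isStrictPureNash hZ _

/-- The factorial moments of the number of equilibria. -/
lemma integral_descFactorial_numStrictPureNash [IsProbabilityMeasure P] [IsProbabilityMeasure ν]
    (hlaw : ∀ i s, HasLaw (Z i s) ν P)
    (hindep : iIndepFun (fun p : Fin N × (Fin N → Fin 2) => Z p.1 p.2) P) (k : ℕ) :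
    ∫ ω, ((numStrictPureNash fun i s => Z i s ω).descFactorial k : ℝ) ∂P =
      numNonadjacent N k * ((1 - tieProbability ν) / 2) ^ (N * k) := by
  classical
  have hnull (f : Fin k ↪ (Fin N → Fin 2)) : NullMeasurableSet
      {ω | ∀ j, IsStrictPureNash (S := fun _ => Fin 2) (fun i s => Z i s ω) (f j)} P := by
    rw [Set.ofPred_forall]
    exact NullMeasurableSet.iInter fun j =>
      nullMeasurableSet_isStrictPureNash (fun i s => (hlaw i s).aemeasurable) _
  simp_rw [descFactorial_numStrictPureNash_eq_sum]
  rw [integral_finsetSum _ fun f _ => (integrable_const _).indicator₀ (hnull f)]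
  simp_rw [fun f => integral_indicator₀ (μ := P) (f := fun _ => (1 : ℝ)) (hnull f)]
  simp [measureReal_forall_isStrictPureNash hlaw hindep, Finset.sum_ite, numNonadjacent,
    Fintype.card_subtype]

lemma integral_numStrictPureNash [IsProbabilityMeasure P] [IsProbabilityMeasure ν]
    (hlaw : ∀ i s, HasLaw (Z i s) ν P)
    (hindep : iIndepFun (fun p : Fin N × (Fin N → Fin 2) => Z p.1 p.2) P) :
    ∫ ω, (numStrictPureNash (fun i s => Z i s ω) : ℝ) ∂P = (1 - tieProbability ν) ^ N := by
  have h := integral_descFactorial_numStrictPureNash hlaw hindep 1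
  simp only [Nat.descFactorial_one, numNonadjacent_one, mul_one] at h
  rw [h, Nat.cast_pow, Nat.cast_ofNat, ← mul_pow, mul_div_cancel₀ _ two_ne_zero]

lemma integral_choose_numStrictPureNash_of_tieProbability_eq_zero [IsProbabilityMeasure P]
    [IsProbabilityMeasure ν] (hlaw : ∀ i s, HasLaw (Z i s) ν P)
    (hindep : iIndepFun (fun p : Fin N × (Fin N → Fin 2) => Z p.1 p.2) P)
    (hν : tieProbability ν = 0) (k : ℕ) :
    ∫ ω, ((numStrictPureNash fun i s => Z i s ω).choose k : ℝ) ∂P =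
      numNonadjacent N k / (2 ^ N) ^ k / k.factorial := by
  have h := integral_descFactorial_numStrictPureNash hlaw hindep k
  simp_rw [Nat.descFactorial_eq_factorial_mul_choose, Nat.cast_mul, integral_const_mul] at h
  rw [eq_div_iff (by positivity), mul_comm, h, hν, pow_mul]
  simp [div_eq_mul_inv]

lemma one_sub_measureReal_numStrictPureNash_eq_zero_le [IsProbabilityMeasure P]
    [IsProbabilityMeasure ν] (hlaw : ∀ i s, HasLaw (Z i s) ν P)
    (hindep : iIndepFun (fun p : Fin N × (Fin N → Fin 2) => Z p.1 p.2) P) :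
    1 - P.real {ω | numStrictPureNash (fun i s => Z i s ω) = 0} ≤ (1 - tieProbability ν) ^ N := by
  have hZ := fun i s => (hlaw i s).aemeasurable
  have hnull : NullMeasurableSet {ω | numStrictPureNash (fun i s => Z i s ω) = 0} P :=
    (aemeasurable_numStrictPureNash hZ).nullMeasurableSet_preimage (measurableSet_singleton 0)
  have hint := integrable_descFactorial_numStrictPureNash hZ 1
  simp only [Nat.descFactorial_one] at hint
  have hmarkov := mul_meas_ge_le_integral_of_nonneg
    (Eventually.of_forall fun ω => Nat.cast_nonneg _) hint 1
  rw [one_mul, integral_numStrictPureNash hlaw hindep] at hmarkov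
  rw [← probReal_compl_eq_one_sub₀ hnull]
  convert hmarkov using 3
  ext ω
  simp [Nat.one_le_iff_ne_zero]

end RandomGame

/-! ### The number of equilibria -/

theorem mainTheorem4
    (ν : Measure ℝ) [IsProbabilityMeasure ν]
    {Ω : ℕ → Type*} [∀ N, MeasurableSpace (Ω N)]
    (P : ∀ N, Measure (Ω N)) [∀ N, IsProbabilityMeasure (P N)]
    (Z : ∀ N, Fin N → (Fin N → Fin 2) → Ω N → ℝ)
    (hlaw : ∀ N (i : Fin N) (s : Fin N → Fin 2), HasLaw (Z N i s) ν (P N))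
    (hindep : ∀ N, iIndepFun (fun p : Fin N × (Fin N → Fin 2) => Z N p.1 p.2) (P N)) :
    (tieProbability ν = 0 →
      TendstoInDistribution
        (fun N (ω : Ω N) => numStrictPureNash (fun i s => Z N i s ω))
        atTop (id : ℕ → ℕ) P (poissonMeasure 1)) ∧
    (0 < tieProbability ν →
      WithVeryHighProbability P
        (fun N => {ω : Ω N | numStrictPureNash (fun i s => Z N i s ω) = 0})) ∧
    (∀ N, Integrable (fun ω : Ω N => (numStrictPureNash (fun i s => Z N i s ω) : ℝ)) (P N) ∧
      ∫ ω : Ω N, (numStrictPureNash (fun i s => Z N i s ω) : ℝ) ∂(P N)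
        = (1 - tieProbability ν) ^ N) := by
  have hZ N := fun i s => (hlaw N i s).aemeasurable
  have hW N := aemeasurable_numStrictPureNash (hZ N)
  refine ⟨fun hν => ⟨hW, aemeasurable_id, ?_⟩, fun hν => ?_, fun N =>
    ⟨by simpa using integrable_descFactorial_numStrictPureNash (hZ N) 1,
      integral_numStrictPureNash (hlaw N) (hindep N)⟩⟩
  · have hmom (N k : ℕ) : ∫ n, (n.choose k : ℝ)
        ∂((P N).map fun ω => numStrictPureNash fun i s => Z N i s ω) =
        numNonadjacent N k / (2 ^ N) ^ k / k.factorial := by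
      rw [integral_map (hW N) (by fun_prop)]
      exact integral_choose_numStrictPureNash_of_tieProbability_eq_zero (hlaw N) (hindep N) hν k
    simp_rw [Measure.map_id]
    refine tendsto_poissonMeasure_of_tendsto_integral_choose (fun N k => ?_) (fun N k => ?_)
      fun k => ?_
    · refine (integrable_map_measure (by fun_prop) (hW N)).2 ?_
      have h := (integrable_descFactorial_numStrictPureNash (hZ N) k).const_mul (k.factorial : ℝ)⁻¹
      refine h.congr (Eventually.of_forall fun ω => ?_)
      simp [Nat.descFactorial_eq_factorial_mul_choose, Nat.factorial_ne_zero]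
    · refine (hmom N k).trans_le ?_
      rw [NNReal.coe_one, one_pow]
      gcongr
      exact numNonadjacent_div_le_one N k
    · rw [NNReal.coe_one, one_pow]
      exact ((tendsto_numNonadjacent_div k).div_const _).congr fun N => (hmom N k).symm
  · have h1 : tieProbability ν ≤ 1 := measureReal_le_one
    have hsum : Summable fun N : ℕ => (1 - tieProbability ν) ^ (N + 1) :=
      (summable_nat_add_iff 1).2 (summable_geometric_of_lt_one (by linarith) (by linarith))
    exact hsum.of_nonneg_of_le (fun N => sub_nonneg.2 measureReal_le_one) fun N =>
      one_sub_measureReal_numStrictPureNash_eq_zero_le (hlaw (N + 1)) (hindep (N + 1))
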